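/- **Setting.** There are $n=3f+1$ validators ($f\ge 0$). An adversary adaptively corrupts at most $f$ of them; those never corrupted are called *honest*. Validators build a DAG of *blocks*. A block has an author, a round in $\{0,1,2,\dots\}$, a list of transactions and an ordered list of referenced blocks. It is *valid* if its references are distinct, go to valid blocks of earlier rounds and, in a round $R>0$, include blocks of round $R-1$ by at least $2f+1$ distinct validators. The *causal history* of a block $b$ is the set of blocks reachable from $b$ along references, including $b$. Signatures cannot be forged, and links between honest validators are reliable and authenticated, with arbitrary finite delays. A validator's *local DAG* consists of the valid blocks whose whole causal history it holds. An honest validator proposes and broadcasts one valid block per round, at increasing times: one in round $0$ and, once its local DAG contains round-$R$ blocks of $2f+1$ validators, one in round $R+1$. The references of that block begin with its own previous block, lie in its local DAG, and are such that every block of an earlier round in its local DAG is in the causal history of the new block. Having received a block, it requests missing blocks of its causal history from the sender; honest validators answer requests for blocks they hold. Corrupted validators may do anything, including equivocate. **Decision rule (wave length $4$).** Let $1\le\ell\le 3f+1$. A common coin assigns $\ell$ distinct validators to the leader slots $(r,0),\dots,(r,\ell-1)$ of each round $r$. Slots are ordered lexicographically. A block *votes* for a block $b$ of author $a$ and round $r$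 if $b$ is the first block of author $a$ and round $r$ met in the depth-first search along its ordered references. A *certificate* for $b$ is a block of round $r+3$ that references round-$(r+2)$ votes for $b$ by $2f+1$ distinct validators. In a local DAG, the coin of round $r$ is open if there are round-$(r+3)$ blocks by $2f+1$ validators. A slot $(r,i)$ whose coin is open is * directly committed with a block $b$ in it (i.e. a block of round $r$ by the slot's leader) if $2f+1$ validators have certificates for $b$; * directly skipped if, for each block $b$ in it, $2f+1$ validators have a round-$(r+2)$ block not voting for $b$. If neither applies, consider the slot's anchor, the first slot of a round $>r+3$ that is not skipped. If the anchor is committed with a block $a$, then the slot is committed with a block $b$ in it for which the causal history of $a$ contains a certificate, and skipped if there is no such $b$. Otherwise the slot is undecided. A block is *delivered* if it is in the causal history of the block committed in some slot, all earlier slots are decided (committed or skipped), and it is not in the causal history of the block of an earlier committed slot. **Network models.** In the *asynchronous model* the adversary chooses, round by round, which blocks each uncorrupted validator receives. Let $\mathcal F_R$ be a filtration representing the information available through round $R$; it determines which validators have been corrupted by round $R$, the round-$R$ blocks of the uncorrupted validators, and the coins of the rounds $r\le R-3$. The coin of round $r$ is released in round $r+3$ and is perfect: conditionally on $\mathcal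 F_{r+2}$, the leader of each slot of round $r$ is uniformly distributed over the $3f+1$ validators. In the *random network model*, in addition, for each round $R$ and, conditionally on $\mathcal F_R$, independently for each uncorrupted validator $v$, a uniformly random set of $2f+1$ of the validators that have a round-$R$ block taking part (all uncorrupted ones, and corrupted ones at the adversary's choice) is drawn; the round-$R$ blocks referenced by $v$'s block of round $R+1$ are blocks of exactly these validators and of $v$ itself. **Theorem (Validity, wave length $4$).** Both in the asynchronous and in the random network model, with probability $1$, every block broadcast by an honest validator is eventually delivered by every honest validator. -/

import Mathlib

open MeasureTheory
open scoped ENNReal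

/-- The `n = 3f + 1` validators. -/
abbrev Validator (f : ℕ) : Type := Fin (3 * f + 1)

/-- Blocks.  A block consists of its author, its round, its list of transactions and the ordered list
of the blocks it references.  Signatures and hashes are idealized: a hash reference is the referenced
block itself, and only correctly signed blocks are represented (see `FollowsProtocol.unforgeable`). -/
inductive Block (f : ℕ) (Tx : Type*) : Type _
  | mk (author : Validator f) (round : ℕ) (transactions : List Tx) (parents : List (Block f Tx)) :
      Block f Tx

namespace Block

variable {f : ℕ} {Tx : Type*}

def author : Block f Tx → Validator f
  | mk a _ _ _ => a

/-- Rounds are numbered from `0`; blocks of round `0` reference nothing. -/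
def round : Block f Tx → ℕ
  | mk _ r _ _ => r

def parents : Block f Tx → List (Block f Tx)
  | mk _ _ _ ps => ps

/-- `x.InHistory b`: there is a path from `b` to `x`, i.e. `x` lies in the causal history of `b`
(which contains `b` itself). -/
def InHistory (x b : Block f Tx) : Prop :=
  Relation.ReflTransGen (fun p c : Block f Tx => p ∈ c.parents) x b

end Block

/-- A set of blocks that contains blocks of at least `2f + 1` distinct validators. -/
def IsQuorum {f : ℕ} {Tx : Type*} (S : Set (Block f Tx)) : Prop :=
  2 * f + 1 ≤ (Block.author '' S).ncard

namespace Block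

variable {f : ℕ} {Tx : Type*}

/-- The references are distinct and go to earlier rounds and, except in the first round, they include
blocks of the previous round by `2f + 1` validators. -/
structure WellFormed (b : Block f Tx) : Prop where
  nodup : b.parents.Nodup
  earlier : ∀ p ∈ b.parents, p.round < b.round
  quorum : b.round ≠ 0 → IsQuorum {p | p ∈ b.parents ∧ p.round + 1 = b.round}

/-- A valid block: it and (recursively) all blocks that it references are well formed. -/
def Valid (b : Block f Tx) : Prop :=
  ∀ x : Block f Tx, x.InHistory b → x.WellFormed

mutual
/-- Depth-first search, from a block along its references in their order, for the first block of
validator `id` and round `r`. -/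
def votedBlock (id : Validator f) (r : ℕ) : Block f Tx → Option (Block f Tx)
  | mk _ ρ _ ps => if ρ ≤ r then none else votedAmong id r ps
/-- The loop over the references in `votedBlock`. -/
def votedAmong (id : Validator f) (r : ℕ) : List (Block f Tx) → Option (Block f Tx)
  | [] => none
  | b :: bs =>
      if b.author = id ∧ b.round = r then some b
      else
        match votedBlock id r b with
        | some x => some x
        | none => votedAmong id r bs
end

/-- `p.IsVote b`: the block `p` votes for the block `b`. -/
def IsVote (p b : Block f Tx) : Prop :=
  votedBlock b.author b.round p = some b

end Block

/-! A wave of length `4` that starts in the propose round `r` has the boost round `r + 1`, the vote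
round `r + 2` and the certify round `r + 3`. -/

def voteRound (r : ℕ) : ℕ := r + 2

def certifyRound (r : ℕ) : ℕ := r + 3

/-- `c.IsCert b`: the block `c` of the certify round of `b` is a certificate for `b`, i.e. it
references votes for `b` by `2f + 1` validators from the vote round. -/
def Block.IsCert {f : ℕ} {Tx : Type*} (c b : Block f Tx) : Prop :=
  c.round = certifyRound b.round ∧
    IsQuorum {p | p ∈ c.parents ∧ p.round = voteRound b.round ∧ p.IsVote b}

/-- A leader slot `(r, i)`: the `i`-th of the `ℓ` leader slots of round `r`. -/
abbrev Slot (ℓ : ℕ) : Type := ℕ × Fin ℓ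

/-- The order of the leader slots: by round, then by index. -/
def Slot.Before {ℓ : ℕ} (s s' : Slot ℓ) : Prop :=
  Prod.Lex (· < ·) (· < ·) s s'

/-! The decision rule.  `D` is a local DAG, `leader r i` the validator that the coin elects for the
slot `(r, i)`. -/

section DecisionRule

variable {f ℓ : ℕ} {Tx : Type*}

/-- The coin of the wave starting in round `r` can be reconstructed: `D` contains coin shares, i.e.
blocks of the certify round, of `2f + 1` validators. -/
def CoinOpen (D : Set (Block f Tx)) (r : ℕ) : Prop :=
  IsQuorum {c | c ∈ D ∧ c.round = certifyRound r}

/-- The blocks in a slot (possibly none, possibly several equivocating ones). -/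
def LeaderBlocks (D : Set (Block f Tx)) (leader : ℕ → Fin ℓ ↪ Validator f) (s : Slot ℓ) :
    Set (Block f Tx) :=
  {b | b ∈ D ∧ b.round = s.1 ∧ b.author = leader s.1 s.2}

/-- `2f + 1` validators have a block of the vote round that does not vote for `b`. -/
def SkippedLeader (D : Set (Block f Tx)) (b : Block f Tx) : Prop :=
  IsQuorum {p | p ∈ D ∧ p.round = voteRound b.round ∧ ¬ p.IsVote b}

/-- `2f + 1` validators have a certificate for `b`. -/
def SupportedLeader (D : Set (Block f Tx)) (b : Block f Tx) : Prop :=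
  IsQuorum {c | c ∈ D ∧ c.IsCert b}

/-- The direct decision rule; `some b` stands for `commit b` and `none` for `skip`.  (Once the coin is
open, `D` contains vote-round blocks by `2f + 1` validators, so an empty slot, for which none of them
can vote, is skipped.) -/
def DirectDecision (D : Set (Block f Tx)) (leader : ℕ → Fin ℓ ↪ Validator f) (s : Slot ℓ) :
    Option (Block f Tx) → Prop
  | some b => CoinOpen D s.1 ∧ b ∈ LeaderBlocks D leader s ∧ SupportedLeader D b
  | none => CoinOpen D s.1 ∧ ∀ b ∈ LeaderBlocks D leader s, SkippedLeader D b

/-- A certificate for `b` lies in the causal history of `anchor`. -/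
def CertifiedLink (D : Set (Block f Tx)) (anchor b : Block f Tx) : Prop :=
  ∃ c ∈ D, c.IsCert b ∧ c.InHistory anchor

/-- What the indirect decision rule decides for the slot `s` when its anchor is committed with the
block `anchor`. -/
def IndirectDecision (D : Set (Block f Tx)) (leader : ℕ → Fin ℓ ↪ Validator f)
    (anchor : Block f Tx) (s : Slot ℓ) : Option (Block f Tx) → Prop
  | some b => CoinOpen D s.1 ∧ b ∈ LeaderBlocks D leader s ∧ CertifiedLink D anchor b
  | none => CoinOpen D s.1 ∧ ∀ b ∈ LeaderBlocks D leader s, ¬ CertifiedLink D anchor b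

/-- `Decided D leader s (some b)`: the slot `s` is committed with the block `b`;
`Decided D leader s none`: the slot is skipped.  A slot is undecided if neither can be derived.
The anchor of a slot is the first slot after its certify round that is not skipped. -/
inductive Decided (D : Set (Block f Tx)) (leader : ℕ → Fin ℓ ↪ Validator f) :
    Slot ℓ → Option (Block f Tx) → Prop
  | direct (s : Slot ℓ) (d : Option (Block f Tx)) (h : DirectDecision D leader s d) :
      Decided D leader s d
  | indirect (s anchorSlot : Slot ℓ) (anchor : Block f Tx) (d : Option (Block f Tx))
      (not_direct : ∀ d', ¬ DirectDecision D leader s d')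
      (later : certifyRound s.1 < anchorSlot.1)
      (skipped : ∀ s' : Slot ℓ, certifyRound s.1 < s'.1 → s'.Before anchorSlot →
        Decided D leader s' none)
      (committed : Decided D leader anchorSlot (some anchor))
      (h : IndirectDecision D leader anchor s d) :
      Decided D leader s d

/-- The block `b` is delivered in the local DAG `D`: it is in the causal history of the block `l`
committed in a slot `s`, all slots before `s` are decided, and `b` is not in the causal history of the
block of an earlier committed slot. -/
def DeliveredIn (D : Set (Block f Tx)) (leader : ℕ → Fin ℓ ↪ Validator f) (b : Block f Tx) : Prop :=
  ∃ (s : Slot ℓ) (l : Block f Tx),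
    Decided D leader s (some l) ∧ b.InHistory l ∧
    (∀ s' : Slot ℓ, s'.Before s → ∃ d, Decided D leader s' d) ∧
    ∀ s' : Slot ℓ, s'.Before s → ∀ l', Decided D leader s' (some l') → ¬ b.InHistory l'

end DecisionRule

/-- Messages: a block, or the request of the synchronizer for a missing block. -/
inductive Message (f : ℕ) (Tx : Type*) : Type _
  | block (b : Block f Tx) : Message f Tx
  | request (b : Block f Tx) : Message f Tx

/-- The record of one execution with `ℓ` leader slots per round.  Time is counted in steps. -/
structure Execution (f ℓ : ℕ) (Tx : Type*) where
  /-- the validators that the adversary has corrupted before their block of the given round -/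
  faulty : ℕ → Finset (Validator f)
  /-- the block that a validator proposes in a round while it follows the protocol, if any -/
  proposal : Validator f → ℕ → Option (Block f Tx)
  /-- the time at which it does so -/
  proposalTime : Validator f → ℕ → ℕ
  /-- `sent u v t`: the messages that `u` has sent to `v` up to time `t` -/
  sent : Validator f → Validator f → ℕ → Set (Message f Tx)
  /-- `received v u t`: the messages that `v` has received from `u` up to time `t` -/
  received : Validator f → Validator f → ℕ → Set (Message f Tx)
  /-- the validators elected by the common coin for the `ℓ` leader slots of a round -/
  leader : ℕ → Fin ℓ ↪ Validator f

namespace Execution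

variable {f ℓ : ℕ} {Tx : Type*} (X : Execution f ℓ Tx)

/-- Honest validators are those that are never corrupted. -/
def Honest (v : Validator f) : Prop := ∀ R, v ∉ X.faulty R

/-- The blocks that `v` has received or created up to time `t`. -/
def store (v : Validator f) (t : ℕ) : Set (Block f Tx) :=
  {b | (∃ u, Message.block b ∈ X.received v u t) ∨
    ∃ R, X.proposal v R = some b ∧ X.proposalTime v R ≤ t}

/-- The local DAG of `v` at time `t`: the valid blocks whose entire causal history `v` has. -/
def dag (v : Validator f) (t : ℕ) : Set (Block f Tx) :=
  {b | b.Valid ∧ ∀ x : Block f Tx, x.InHistory b → x ∈ X.store v t}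

/-- The laws of an execution: at most `f` validators are corrupted, in the course of the execution;
honest validators follow the protocol; signatures of honest validators cannot be forged; links between
honest validators are reliable, with arbitrary finite delays.  Nothing else is required of corrupted
validators. -/
structure FollowsProtocol : Prop where
  /-- corruption is permanent and affects at most `f` validators -/
  faulty_mono : Monotone X.faulty
  faulty_card : ∀ R, (X.faulty R).card ≤ f
  /-- the messages sent and received up to a time accumulate -/
  sent_mono : ∀ v u, X.Honest v → Monotone (X.sent v u)
  received_mono : ∀ v u, X.Honest v → Monotone (X.received v u)
  /-- links between honest validators are authenticated and reliable -/
  authentic : ∀ u v t, X.Honest u → X.Honest v → X.received v u t ⊆ X.sent u v t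
  reliable : ∀ u v t m, X.Honest u → X.Honest v → m ∈ X.sent u v t → ∃ t', m ∈ X.received v u t'
  /-- a block by an honest `v` that another honest validator holds has been proposed by `v` before -/
  unforgeable : ∀ u v t b, X.Honest u → X.Honest v → b ∈ X.dag u t → b.author = v →
    X.proposal v b.round = some b ∧ X.proposalTime v b.round ≤ t
  /-- what an honest validator proposes in round `R` is a valid block of its own of that round -/
  proposal_valid : ∀ v R b, X.Honest v → X.proposal v R = some b →
    b.author = v ∧ b.round = R ∧ b.Valid
  /-- only blocks are referenced whose entire causal history has been downloaded -/
  proposal_parents : ∀ v R b, X.Honest v → X.proposal v R = some b →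
    ∀ p ∈ b.parents, p ∈ X.dag v (X.proposalTime v R)
  /-- the references start with the validator's own block of the round before -/
  proposal_own : ∀ v R b, X.Honest v → X.proposal v (R + 1) = some b →
    X.proposalTime v R < X.proposalTime v (R + 1) ∧
    ∃ own, X.proposal v R = some own ∧ b.parents.head? = some own
  /-- all blocks of earlier rounds in the local DAG are referenced, unless they already are in the
  causal history of the new block -/
  proposal_refers : ∀ v R b, X.Honest v → X.proposal v R = some b →
    ∀ x ∈ X.dag v (X.proposalTime v R), x.round < R → x.InHistory b
  /-- every honest validator proposes a block in the first round, and in each further round once it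
  has blocks of `2f + 1` validators from the round before -/
  propose_first : ∀ v, X.Honest v → ∃ b, X.proposal v 0 = some b
  propose_next : ∀ v R t b, X.Honest v → X.proposal v R = some b →
    IsQuorum {x | x ∈ X.dag v t ∧ x.round = R} → ∃ b', X.proposal v (R + 1) = some b'
  /-- proposals are broadcast to all validators -/
  broadcast : ∀ v R b u, X.Honest v → X.proposal v R = some b →
    Message.block b ∈ X.sent v u (X.proposalTime v R)
  /-- synchronizer: having received `b` from `u`, an honest validator asks `u` for each block `y`
  that it sees referenced in the causal history of `b` and that it does not get otherwise -/
  sync_request : ∀ v u t b x y, X.Honest v → Message.block b ∈ X.received v u t →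
    x.InHistory b → x ∈ X.store v t → y ∈ x.parents →
    ∃ t', y ∈ X.store v t' ∨ Message.request y ∈ X.sent v u t'
  /-- synchronizer: honest validators answer requests for blocks that they have -/
  sync_reply : ∀ u v t y, X.Honest u → Message.request y ∈ X.received u v t →
    y ∈ X.store u t → ∃ t', Message.block y ∈ X.sent u v t'

/-- Validity: each block broadcast by an honest validator is eventually delivered by each honest
validator. -/
def Validity : Prop :=
  ∀ v R b, X.Honest v → X.proposal v R = some b →
    ∀ u, X.Honest u → ∃ t, DeliveredIn (X.dag u t) X.leader b

end Execution

section Networks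

variable {f ℓ : ℕ} {Tx : Type*} {Ω : Type*} [mΩ : MeasurableSpace Ω]

/-- The asynchronous network model with a global perfect coin.  `X` is the random execution that
arises from the coin and from an adversary that corrupts validators adaptively, chooses the messages of
corrupted validators and schedules all messages, possibly with randomness of its own.  `ℱ R` is the
information available through round `R`: it determines who has been corrupted, the blocks of round `R`
of the uncorrupted validators, and the coins opened in rounds up to `R`.  The coin that elects the
leaders of round `r` is opened in the certify round `r + 3`: given all information through the vote
round `r + 2`, each leader slot of round `r` is assigned to each validator with the same probability.
(The leaders of a round are distinct.  Both `ℓ` consecutive validators from a uniform starting point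
and a uniformly random sequence of `ℓ` distinct validators are of this kind.) -/
structure AsynchronousNetwork (μ : Measure Ω) (ℱ : Filtration ℕ mΩ)
    (X : Ω → Execution f ℓ Tx) : Prop where
  follows : ∀ᵐ ω ∂μ, (X ω).FollowsProtocol
  faulty_known : ∀ R v, MeasurableSet[ℱ R] {ω | v ∈ (X ω).faulty R}
  proposal_known : ∀ R v (S : Set (Block f Tx)),
    MeasurableSet[ℱ R] {ω | v ∉ (X ω).faulty R ∧ ∃ b ∈ S, (X ω).proposal v R = some b}
  coin_known : ∀ r i v, MeasurableSet[ℱ (certifyRound r)] {ω | (X ω).leader r i = v}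
  coin_fair : ∀ r i v (E : Set Ω), MeasurableSet[ℱ (voteRound r)] E →
    μ (E ∩ {ω | (X ω).leader r i = v}) = μ E * ((3 * f + 1 : ℕ) : ℝ≥0∞)⁻¹

/-- The random network model: in addition, for each round `R` and independently for each uncorrupted
validator `v`, a set of `2f + 1` validators is drawn uniformly at random among those that have a block
of round `R` (all uncorrupted ones, and those corrupted ones that the adversary lets take part); the
round-`R` blocks that `v` receives from others and references in its block of round `R + 1` are
blocks of the validators drawn (its own block of round `R` it has and references anyway). -/
structure RandomNetwork (μ : Measure Ω) (ℱ : Filtration ℕ mΩ)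
    (X : Ω → Execution f ℓ Tx) : Prop extends AsynchronousNetwork μ ℱ X where
  random_schedule : ∃ (taking_part : ℕ → Ω → Finset (Validator f))
      (drawn : ℕ → Validator f → Ω → Finset (Validator f)),
    (∀ R a, MeasurableSet[ℱ R] {ω | taking_part R ω = a}) ∧
    (∀ R ω v, v ∉ (X ω).faulty R → v ∈ taking_part R ω) ∧
    (∀ R (a : Finset (Validator f)) (s : Validator f → Finset (Validator f)) (E : Set Ω),
      (∀ v, s v ⊆ a ∧ (s v).card = 2 * f + 1) → MeasurableSet[ℱ R] E →
      μ (E ∩ {ω | taking_part R ω = a} ∩ {ω | ∀ v, drawn R v ω = s v}) =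
        μ (E ∩ {ω | taking_part R ω = a}) *
          ((a.card.choose (2 * f + 1) : ℝ≥0∞)⁻¹) ^ (3 * f + 1)) ∧
    ∀ᵐ ω ∂μ, ∀ R v b, v ∉ (X ω).faulty (R + 1) → (X ω).proposal v (R + 1) = some b →
      Block.author '' {p | p ∈ b.parents ∧ p.round = R} = insert v (drawn R v ω : Set (Validator f))

end Networks

-- Once corruption has stopped, the honest validators form a fixed set H of at least 2f+1. An honest
-- block of round r+1 references round-r blocks of 2f+1 validators, hence of at least f+1 members of
-- H; averaging over H gives an honest v referenced by f+1 honest blocks of round r+1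
-- (`exists_commonCore`). Every block of round r+2 in an honest local DAG references one of these,
-- so its search for a block of v succeeds, and v has only one block in round r. Hence all blocks of
-- round r+2 vote for it, all of round r+3 certify it, and if v is elected its slot is directly
-- committed.
--
-- Such a v can be chosen from `ℱ (r + 2)`, before the coin of round r is revealed, so the coin hits
-- it with probability 1/n, n = 3f+1, whatever the adversary does. Successive windows of four rounds
-- each succeed with conditional probability n^(-4), so almost surely successful windows occur
-- arbitrarily late (`ae_exists_coin_eq_guess`).
--
-- Four consecutive committed first slots settle all earlier slots by descending induction on the
-- round (`exists_decided_of_four_committed`): an anchor search starts four rounds above its slot,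
-- so it cannot jump over the window. The leader block opening a late enough window has the given
-- honest block in its history, which is therefore delivered. The random network model is a special
-- case of the asynchronous one.

namespace Block

variable {f : ℕ} {Tx : Type*}

-- Causal histories and depth-first search

theorem InHistory.refl (b : Block f Tx) : b.InHistory b := Relation.ReflTransGen.refl

theorem InHistory.trans {x y z : Block f Tx} (h : x.InHistory y) (h' : y.InHistory z) :
    x.InHistory z := Relation.ReflTransGen.trans h h'

theorem InHistory.of_mem_parents {p b : Block f Tx} (h : p ∈ b.parents) : p.InHistory b :=
  Relation.ReflTransGen.single h

theorem inHistory_iff {x b : Block f Tx} :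
    x.InHistory b ↔ x = b ∨ ∃ p ∈ b.parents, x.InHistory p := by
  constructor
  · intro h
    rcases Relation.ReflTransGen.cases_tail h with h | ⟨p, hp, hpb⟩
    · exact Or.inl h.symm
    · exact Or.inr ⟨p, hpb, hp⟩
  · rintro (rfl | ⟨p, hp, hx⟩)
    · exact .refl _
    · exact hx.trans (.of_mem_parents hp)

theorem Valid.of_inHistory {x b : Block f Tx} (hb : b.Valid) (h : x.InHistory b) : x.Valid :=
  fun y hy => hb y (hy.trans h)

/-- Finiteness allows one time to bound the arrival times of all blocks of a history. -/
theorem finite_history (b : Block f Tx) : {x : Block f Tx | x.InHistory b}.Finite := by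
  induction hn : sizeOf b using Nat.strong_induction_on generalizing b with
  | _ n ih =>
    have hps : ∀ p ∈ b.parents, sizeOf p < n := by
      intro p hp
      cases b with
      | mk a r tx ps =>
        have := List.sizeOf_lt_of_mem hp
        simp only [parents] at this
        simp only [mk.sizeOf_spec] at hn
        omega
    have : {x : Block f Tx | x.InHistory b} =
        {b} ∪ ⋃ p ∈ {p | p ∈ b.parents}, {x | x.InHistory p} := by
      ext x
      simp [inHistory_iff (x := x) (b := b)]
    rw [this]
    exact (Set.finite_singleton b).union
      ((List.finite_toSet b.parents).biUnion fun p hp => ih _ (hps p hp) p rfl)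

mutual
theorem votedBlock_spec (id : Validator f) (r : ℕ) : (b : Block f Tx) → ∀ x,
    votedBlock id r b = some x → x.author = id ∧ x.round = r ∧ x.InHistory b
  | mk a ρ tx ps => by
    intro x h
    rw [votedBlock] at h
    split_ifs at h
    obtain ⟨h1, h2, p, hp, hx⟩ := votedAmong_spec id r ps x h
    exact ⟨h1, h2, hx.trans (.of_mem_parents hp)⟩
theorem votedAmong_spec (id : Validator f) (r : ℕ) : (bs : List (Block f Tx)) → ∀ x,
    votedAmong id r bs = some x → x.author = id ∧ x.round = r ∧ ∃ p ∈ bs, x.InHistory p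
  | [] => by intro x h; simp [votedAmong] at h
  | b :: bs => by
    intro x h
    rw [votedAmong] at h
    split_ifs at h with hb
    · obtain rfl := Option.some.inj h
      exact ⟨hb.1, hb.2, b, by simp, .refl _⟩
    · split at h
      · rename_i y hy
        obtain rfl := Option.some.inj h
        obtain ⟨h1, h2, h3⟩ := votedBlock_spec id r b y hy
        exact ⟨h1, h2, b, by simp, h3⟩
      · obtain ⟨h1, h2, p, hp, h3⟩ := votedAmong_spec id r bs x h
        exact ⟨h1, h2, p, by simp [hp], h3⟩
end

/-- A reference before `q` may end the search with another block, so only success is asserted. The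
disjunction in `h` makes the argument chainable along a path of references. -/
theorem votedAmong_ne_none {id : Validator f} {r : ℕ} {q : Block f Tx}
    (h : (q.author = id ∧ q.round = r) ∨ votedBlock id r q ≠ none) (bs : List (Block f Tx))
    (hq : q ∈ bs) : votedAmong id r bs ≠ none := by
  induction bs with
  | nil => simp at hq
  | cons b bs ih =>
    rw [votedAmong]
    split_ifs with hb
    · simp
    · split
      · simp
      · rename_i hn
        rcases List.mem_cons.1 hq with rfl | hq
        · rcases h with h | h
          · exact absurd h hb
          · exact absurd hn h
        · exact ih hq

theorem votedBlock_ne_none {id : Validator f} {r : ℕ} {p q : Block f Tx} (hr : r < p.round)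
    (hq : q ∈ p.parents)
    (h : (q.author = id ∧ q.round = r) ∨ votedBlock id r q ≠ none) :
    votedBlock id r p ≠ none := by
  cases p with
  | mk a ρ tx ps =>
    rw [votedBlock, if_neg (by simpa [round] using hr)]
    exact votedAmong_ne_none h ps hq

end Block

-- Quorum intersection

theorem isQuorum_mono {f : ℕ} {Tx : Type*} {S T : Set (Block f Tx)} (h : S ⊆ T)
    (hS : IsQuorum S) : IsQuorum T :=
  le_trans hS (Set.ncard_le_ncard (Set.image_mono h) (Set.toFinite _))

/-- A quorum contains a block of each set of more than `f` validators. -/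
theorem IsQuorum.exists_author_mem {f : ℕ} {Tx : Type*} {S : Set (Block f Tx)} (hS : IsQuorum S)
    (W : Finset (Validator f)) (hW : f + 1 ≤ W.card) : ∃ b ∈ S, b.author ∈ W := by
  classical
  by_contra! h
  have hd : Disjoint (Block.author '' S) (W : Set (Validator f)) := by
    rw [Set.disjoint_left]
    rintro _ ⟨b, hb, rfl⟩
    exact h b hb
  -- Disjointness is impossible since (2f+1) + (f+1) > 3f+1.
  have h1 := Set.ncard_union_eq hd (Set.toFinite _) (Set.toFinite _)
  have h2 := Set.ncard_le_card (Block.author '' S ∪ (W : Set (Validator f)))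
  rw [Set.ncard_coe_finset] at h1
  simp only [Nat.card_eq_fintype_card, Fintype.card_fin] at h2
  unfold IsQuorum at hS
  omega

-- Block propagation and liveness

namespace Execution

variable {f ℓ : ℕ} {Tx : Type*} {X : Execution f ℓ Tx}

theorem mem_dag_of_inHistory {v : Validator f} {t : ℕ} {x b : Block f Tx} (hb : b ∈ X.dag v t)
    (h : x.InHistory b) : x ∈ X.dag v t :=
  ⟨hb.1.of_inHistory h, fun _ hy => hb.2 _ (hy.trans h)⟩

namespace FollowsProtocol

variable (hX : X.FollowsProtocol)
include hX

theorem store_mono {v : Validator f} (hv : X.Honest v) : Monotone (X.store v) := by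
  intro s t hst b hb
  rcases hb with ⟨u, hu⟩ | ⟨R, hR, ht⟩
  · exact Or.inl ⟨u, hX.received_mono v u hv hst hu⟩
  · exact Or.inr ⟨R, hR, ht.trans hst⟩

theorem dag_mono {v : Validator f} (hv : X.Honest v) : Monotone (X.dag v) :=
  fun _ _ hst _ hb => ⟨hb.1, fun x hx => hX.store_mono hv hst (hb.2 x hx)⟩

theorem proposal_mem_dag {v : Validator f} {R : ℕ} {b : Block f Tx} (hv : X.Honest v)
    (hb : X.proposal v R = some b) : b ∈ X.dag v (X.proposalTime v R) := by
  refine ⟨(hX.proposal_valid v R b hv hb).2.2, fun x hx => ?_⟩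
  rcases Block.inHistory_iff.1 hx with rfl | ⟨p, hp, hx⟩
  · exact Or.inr ⟨R, hb, le_rfl⟩
  · exact (hX.proposal_parents v R b hv hb p hp).2 x hx

/-- Each block of the causal history of a block proposed by an honest validator reaches each honest
validator. -/
theorem exists_mem_store {v u : Validator f} {R : ℕ} {b : Block f Tx} (hv : X.Honest v)
    (hu : X.Honest u) (hb : X.proposal v R = some b) {x : Block f Tx} (hx : x.InHistory b) :
    ∃ t, x ∈ X.store u t := by
  obtain ⟨t₀, ht₀⟩ := hX.reliable v u _ _ hv hu (hX.broadcast v R b u hv hb)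
  have hdag := hX.proposal_mem_dag hv hb
  -- The induction descends from `b`: a reference of a block already held can be requested from `v`,
  -- which holds the whole history of `b`.
  induction hx using Relation.ReflTransGen.head_induction_on with
  | refl => exact ⟨t₀, Or.inl ⟨v, ht₀⟩⟩
  | @head y x hyx hxb ih =>
    obtain ⟨t₁, ht₁⟩ := ih
    obtain ⟨t₂, h | h⟩ := hX.sync_request u v (max t₀ t₁) b x y hu
      (hX.received_mono u v hu (le_max_left _ _) ht₀) hxb
      (hX.store_mono hu (le_max_right _ _) ht₁) hyx
    · exact ⟨t₂, h⟩
    · obtain ⟨t₃, ht₃⟩ := hX.reliable u v _ _ hu hv h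
      have hy : y ∈ X.store v (X.proposalTime v R) :=
        hdag.2 y (Relation.ReflTransGen.head hyx hxb)
      obtain ⟨t₄, ht₄⟩ := hX.sync_reply v u (max t₃ (X.proposalTime v R)) y hv
        (hX.received_mono v u hv (le_max_left _ _) ht₃)
        (hX.store_mono hv (le_max_right _ _) hy)
      obtain ⟨t₅, ht₅⟩ := hX.reliable v u _ _ hv hu ht₄
      exact ⟨t₅, Or.inl ⟨v, ht₅⟩⟩

theorem exists_mem_dag {v u : Validator f} {R : ℕ} {b : Block f Tx} (hv : X.Honest v)
    (hu : X.Honest u) (hb : X.proposal v R = some b) : ∃ t, b ∈ X.dag u t := by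
  have h : ∀ x : Block f Tx, ∃ t, x.InHistory b → x ∈ X.store u t := by
    intro x
    by_cases hx : x.InHistory b
    · obtain ⟨t, ht⟩ := hX.exists_mem_store hv hu hb hx
      exact ⟨t, fun _ => ht⟩
    · exact ⟨0, fun h => absurd h hx⟩
  choose T hT using h
  obtain ⟨M, hM⟩ := (b.finite_history.image T).bddAbove
  exact ⟨M, (hX.proposal_valid v R b hv hb).2.2, fun x hx =>
    hX.store_mono hu (hM ⟨x, hx, rfl⟩) (hT x hx)⟩

/-- From some round on, the corrupted validators are exactly those that are not honest. -/
theorem exists_forall_honest_iff : ∃ T, ∀ R, T ≤ R → ∀ v, v ∉ X.faulty R ↔ X.Honest v := by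
  have h : ∀ v, ∃ R, ¬ X.Honest v → v ∈ X.faulty R := by
    intro v
    by_cases hv : X.Honest v
    · exact ⟨0, fun h => absurd hv h⟩
    · simp only [Honest, not_forall, not_not] at hv
      exact hv.imp fun R hR _ => hR
  choose T hT using h
  refine ⟨Finset.univ.sup T, fun R hR v => ⟨fun hv => ?_, fun hv => hv R⟩⟩
  by_contra hn
  exact hv (hX.faulty_mono ((Finset.le_sup (Finset.mem_univ v)).trans hR) (hT v hn))

/-- Corruption is stationary from some round on, so the bound f for a single round covers all
validators ever corrupted. -/
theorem two_mul_add_one_le_card (H : Finset (Validator f)) (hH : ∀ v, v ∈ H ↔ X.Honest v) :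
    2 * f + 1 ≤ H.card := by
  classical
  obtain ⟨T, hT⟩ := hX.exists_forall_honest_iff
  have h1 : Hᶜ = X.faulty T := by
    ext v
    rw [Finset.mem_compl, hH, ← hT T le_rfl v, not_not]
  have h2 := hX.faulty_card T
  have h3 := H.card_add_card_compl
  rw [h1, Fintype.card_fin] at h3
  omega

theorem isQuorum_of_honest {S : Set (Block f Tx)}
    (hS : ∀ v, X.Honest v → ∃ b ∈ S, b.author = v) : IsQuorum S := by
  classical
  have h := hX.two_mul_add_one_le_card (Finset.univ.filter X.Honest) (by simp)
  refine h.trans ?_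
  rw [← Set.ncard_coe_finset]
  refine Set.ncard_le_ncard (fun v hv => ?_) (Set.toFinite _)
  exact hS v (by simpa using hv)

/-- No deadlock: the honest blocks of a round reach every honest validator and already form the
quorum needed to move on. -/
theorem exists_proposal (R : ℕ) : ∀ v, X.Honest v → ∃ b, X.proposal v R = some b := by
  induction R with
  | zero => exact hX.propose_first
  | succ R ih =>
    intro u hu
    have h : ∀ v, ∃ t, X.Honest v → ∃ b, X.proposal v R = some b ∧ b ∈ X.dag u t := by
      intro v
      by_cases hv : X.Honest v
      · obtain ⟨b, hb⟩ := ih v hv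
        obtain ⟨t, ht⟩ := hX.exists_mem_dag hv hu hb
        exact ⟨t, fun _ => ⟨b, hb, ht⟩⟩
      · exact ⟨0, fun h => absurd h hv⟩
    choose T hT using h
    obtain ⟨b, hb⟩ := ih u hu
    refine hX.propose_next u R (Finset.univ.sup T) b hu hb (hX.isQuorum_of_honest fun v hv => ?_)
    obtain ⟨c, hc, hcT⟩ := hT v hv
    obtain ⟨h1, h2, -⟩ := hX.proposal_valid v R c hv hc
    exact ⟨c, ⟨hX.dag_mono hu (Finset.le_sup (Finset.mem_univ v)) hcT, h2⟩, h1⟩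

/-- Late rounds happen late, so a block received at any fixed time precedes all proposals of
sufficiently high rounds. -/
theorem le_proposalTime {v : Validator f} (hv : X.Honest v) (R : ℕ) :
    R ≤ X.proposalTime v R := by
  induction R with
  | zero => exact Nat.zero_le _
  | succ R ih =>
    obtain ⟨b, hb⟩ := hX.exists_proposal (R + 1) v hv
    have := (hX.proposal_own v R b hv hb).1
    omega

/-- At some time, an honest validator has all blocks that honest validators propose in the rounds
before `N`. -/
theorem exists_forall_proposal_mem_dag {u : Validator f} (hu : X.Honest u) (N : ℕ) :
    ∃ t, ∀ v R b, R < N → X.Honest v → X.proposal v R = some b → b ∈ X.dag u t := by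
  have h : ∀ q : Validator f × Fin N, ∃ t, ∀ b, X.Honest q.1 → X.proposal q.1 q.2 = some b →
      b ∈ X.dag u t := by
    rintro ⟨v, R⟩
    by_cases hv : X.Honest v
    · obtain ⟨b, hb⟩ := hX.exists_proposal R v hv
      obtain ⟨t, ht⟩ := hX.exists_mem_dag hv hu hb
      refine ⟨t, fun b' _ hb' => ?_⟩
      obtain rfl : b = b' := Option.some.inj (hb.symm.trans hb')
      exact ht
    · exact ⟨0, fun _ h => absurd h hv⟩
  choose T hT using h
  exact ⟨Finset.univ.sup T, fun v R b hR hv hb =>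
    hX.dag_mono hu (Finset.le_sup (Finset.mem_univ (v, ⟨R, hR⟩))) (hT (v, ⟨R, hR⟩) b hv hb)⟩

end FollowsProtocol

-- The common core and direct commits

/-- `v` is not yet corrupted in round `r + 2`, and blocks of round `r` by `v` are referenced in round
`r + 1` by more than `f` validators that are not yet corrupted either. -/
def CommonCore (X : Execution f ℓ Tx) (r : ℕ) (v : Validator f) : Prop :=
  v ∉ X.faulty (r + 2) ∧ ∃ W : Finset (Validator f), f + 1 ≤ W.card ∧ ∀ w ∈ W,
    w ∉ X.faulty (r + 2) ∧ (w ∉ X.faulty (r + 1) ∧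
      ∃ c ∈ {c : Block f Tx | ∃ p ∈ c.parents, p.author = v ∧ p.round = r},
        X.proposal w (r + 1) = some c)

namespace FollowsProtocol

variable (hX : X.FollowsProtocol)
include hX

/-- Double counting of references between honest validators: if each honest block of round r+1
reaches f+1 honest authors, some honest author is reached by f+1 of these blocks. -/
theorem exists_commonCore {r : ℕ} (h1 : ∀ v, v ∉ X.faulty (r + 1) ↔ X.Honest v)
    (h2 : ∀ v, v ∉ X.faulty (r + 2) ↔ X.Honest v) : ∃ v, X.CommonCore r v := by
  classical
  set H : Finset (Validator f) := Finset.univ.filter X.Honest with hH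
  have hmem : ∀ v, v ∈ H ↔ X.Honest v := by simp [hH]
  have hcard := hX.two_mul_add_one_le_card H hmem
  let Q : Validator f → Validator f → Prop := fun w v =>
    ∃ c ∈ {c : Block f Tx | ∃ p ∈ c.parents, p.author = v ∧ p.round = r},
      X.proposal w (r + 1) = some c
  -- Of the 2f+1 authors referenced by `w`, at most f lie outside `H`.
  have hdeg : ∀ w ∈ H, f + 1 ≤ (H.filter (Q w)).card := by
    intro w hw
    obtain ⟨c, hc⟩ := hX.exists_proposal (r + 1) w ((hmem w).1 hw)
    obtain ⟨-, hcr, hcv⟩ := hX.proposal_valid w _ c ((hmem w).1 hw) hc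
    have hq := (hcv c (.refl c)).quorum (by omega)
    by_contra! hlt
    have hsub : Block.author '' {p | p ∈ c.parents ∧ p.round + 1 = c.round} ⊆
        ((H.filter (Q w) ∪ Hᶜ : Finset (Validator f)) : Set (Validator f)) := by
      rintro _ ⟨p, ⟨hp, hpr⟩, rfl⟩
      by_cases hpH : p.author ∈ H
      · have : Q w p.author := ⟨c, ⟨p, hp, rfl, by omega⟩, hc⟩
        simp [hpH, this]
      · simp [hpH]
    have hle := Set.ncard_le_ncard hsub (Set.toFinite _)
    rw [Set.ncard_coe_finset] at hle
    have hu := Finset.card_union_le (H.filter (Q w)) Hᶜ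
    have hcc := H.card_add_card_compl
    rw [Fintype.card_fin] at hcc
    unfold IsQuorum at hq
    omega
  have hsum : ∑ v ∈ H, (H.filter fun w => Q w v).card = ∑ w ∈ H, (H.filter (Q w)).card :=
    (Finset.sum_card_bipartiteAbove_eq_sum_card_bipartiteBelow Q).symm
  have hne : H.Nonempty := Finset.card_pos.1 (by omega)
  obtain ⟨v, hv, hvc⟩ : ∃ v ∈ H, f + 1 ≤ (H.filter fun w => Q w v).card := by
    refine Finset.exists_le_of_sum_le (f := fun _ => f + 1) hne ?_
    rw [hsum]
    exact Finset.sum_le_sum hdeg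
  refine ⟨v, (h2 v).2 ((hmem v).1 hv), H.filter fun w => Q w v, hvc, fun w hw => ?_⟩
  obtain ⟨hwH, hwQ⟩ := Finset.mem_filter.1 hw
  exact ⟨(h2 w).2 ((hmem w).1 hwH), (h1 w).2 ((hmem w).1 hwH), hwQ⟩

/-- Each block of round `r + 2` in the local DAG of an honest validator votes for the block of round
`r` of an honest validator of the common core. -/
theorem isVote_of_commonCore {r : ℕ} (h2 : ∀ v, v ∉ X.faulty (r + 2) ↔ X.Honest v)
    {v : Validator f} (hv : X.CommonCore r v) {b : Block f Tx} (hb : X.proposal v r = some b)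
    {u : Validator f} (hu : X.Honest u) {t : ℕ} {p : Block f Tx} (hp : p ∈ X.dag u t)
    (hpr : p.round = r + 2) : p.IsVote b := by
  obtain ⟨hvf, W, hWc, hW⟩ := hv
  have hvH : X.Honest v := (h2 v).1 hvf
  obtain ⟨hba, hbr, -⟩ := hX.proposal_valid v r b hvH hb
  obtain ⟨q, ⟨hqp, hqr⟩, hqW⟩ :=
    ((hp.1 p (.refl p)).quorum (by omega)).exists_author_mem W hWc
  obtain ⟨hq2, -, c, ⟨x, hxc, hxa, hxr⟩, hc⟩ := hW _ hqW
  have hqd : q ∈ X.dag u t := mem_dag_of_inHistory hp (.of_mem_parents hqp)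
  have hqc : X.proposal q.author q.round = some q :=
    (hX.unforgeable u q.author t q hu ((h2 _).1 hq2) hqd rfl).1
  obtain rfl : q = c := by
    rw [show q.round = r + 1 by omega] at hqc
    exact Option.some.inj (hqc.symm.trans hc)
  -- The path from `p` through `q` to `x` guarantees that the search succeeds, though possibly along
  -- another path.
  have hne : Block.votedBlock v r p ≠ none :=
    Block.votedBlock_ne_none (by omega) hqp
      (Or.inr (Block.votedBlock_ne_none (by omega) hxc (Or.inl ⟨hxa, hxr⟩)))
  obtain ⟨y, hy⟩ := Option.ne_none_iff_exists'.1 hne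
  obtain ⟨hya, hyr, hyp⟩ := Block.votedBlock_spec v r p y hy
  -- Whatever block the search finds, `v` being honest has proposed it, so it is `b`.
  have hyb := (hX.unforgeable u v t y hu hvH (mem_dag_of_inHistory hp hyp) hya).1
  rw [hyr] at hyb
  obtain rfl : y = b := Option.some.inj (hyb.symm.trans hb)
  unfold Block.IsVote
  rw [hba, hbr, hy]

/-- The block of an honest leader of the common core is directly committed. -/
theorem directDecision_of_commonCore {r : ℕ} (h2 : ∀ v, v ∉ X.faulty (r + 2) ↔ X.Honest v)
    {i : Fin ℓ} (hv : X.CommonCore r (X.leader r i)) {b : Block f Tx}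
    (hb : X.proposal (X.leader r i) r = some b) {u : Validator f} (hu : X.Honest u) {t : ℕ}
    (ht : ∀ v R b, R ≤ r + 3 → X.Honest v → X.proposal v R = some b → b ∈ X.dag u t) :
    DirectDecision (X.dag u t) X.leader (r, i) (some b) := by
  have hvH : X.Honest (X.leader r i) := (h2 _).1 hv.1
  obtain ⟨hba, hbr, -⟩ := hX.proposal_valid _ r b hvH hb
  refine ⟨hX.isQuorum_of_honest fun w hw => ?_, ⟨ht _ r b (by omega) hvH hb, hbr, hba⟩,
    hX.isQuorum_of_honest fun w hw => ?_⟩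
  · obtain ⟨c, hc⟩ := hX.exists_proposal (r + 3) w hw
    obtain ⟨hca, hcr, -⟩ := hX.proposal_valid w _ c hw hc
    exact ⟨c, ⟨ht w _ c le_rfl hw hc, hcr⟩, hca⟩
  · obtain ⟨c, hc⟩ := hX.exists_proposal (r + 3) w hw
    obtain ⟨hca, hcr, hcv⟩ := hX.proposal_valid w _ c hw hc
    have hcd := ht w _ c le_rfl hw hc
    refine ⟨c, ⟨hcd, by rw [hcr, hbr]; rfl, ?_⟩, hca⟩
    refine isQuorum_mono ?_ ((hcv c (.refl c)).quorum (by omega))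
    rintro p ⟨hp, hpr⟩
    have hpr' : p.round = r + 2 := by omega
    exact ⟨hp, by rw [hpr', hbr]; rfl, hX.isVote_of_commonCore h2 hv hb hu
      (mem_dag_of_inHistory hcd (.of_mem_parents hp)) hpr'⟩

end FollowsProtocol

end Execution

-- Propagating decisions to earlier slots

section Decisions

variable {f ℓ : ℕ} {Tx : Type*} {D : Set (Block f Tx)} {leader : ℕ → Fin ℓ ↪ Validator f}

theorem Slot.before_trans {a b c : Slot ℓ} (h : a.Before b) (h' : b.Before c) : a.Before c :=
  _root_.trans (r := Prod.Lex (· < ·) (· < ·)) h h'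

theorem Slot.before_wf : WellFounded (Slot.Before (ℓ := ℓ)) :=
  WellFounded.prod_lex wellFounded_lt wellFounded_lt

theorem Slot.before_trichotomy (a b : Slot ℓ) : a.Before b ∨ a = b ∨ b.Before a := by
  simp only [Slot.Before, Prod.lex_def, Prod.ext_iff]
  rcases lt_trichotomy a.1 b.1 with h | h | h <;> rcases lt_trichotomy a.2 b.2 with h' | h' | h' <;>
    simp [h, h']

/-- If a slot after the certify round of `s` is committed and the slots in between are decided, then
`s` is decided. -/
theorem exists_decided_of_later {s s₁ : Slot ℓ} {l : Block f Tx} (hcoin : CoinOpen D s.1)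
    (hs₁ : certifyRound s.1 < s₁.1) (hl : Decided D leader s₁ (some l))
    (hbetween : ∀ s' : Slot ℓ, certifyRound s.1 < s'.1 → s'.Before s₁ →
      ∃ d, Decided D leader s' d) : ∃ d, Decided D leader s d := by
  by_cases hdir : ∃ d, DirectDecision D leader s d
  · exact hdir.imp fun d h => .direct s d h
  push Not at hdir
  -- The least committed slot after the certify round serves as anchor: those in between are decided
  -- but not committed, hence skipped. Uniqueness of decisions is not needed.
  obtain ⟨a, ⟨ha, l', hl'⟩, hmin⟩ := Slot.before_wf.has_min
    {a : Slot ℓ | certifyRound s.1 < a.1 ∧ ∃ l, Decided D leader a (some l)} ⟨s₁, hs₁, l, hl⟩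
  have hskip : ∀ s' : Slot ℓ, certifyRound s.1 < s'.1 → s'.Before a →
      Decided D leader s' none := by
    intro s' h' hb
    have hb₁ : s'.Before s₁ := by
      rcases Slot.before_trichotomy a s₁ with h | rfl | h
      · exact Slot.before_trans hb h
      · exact hb
      · exact absurd h (hmin s₁ ⟨hs₁, l, hl⟩)
    obtain ⟨d, hd⟩ := hbetween s' h' hb₁
    cases d with
    | none => exact hd
    | some x => exact absurd hb (hmin s' ⟨h', x, hd⟩)
  by_cases hc : ∃ b ∈ LeaderBlocks D leader s, CertifiedLink D l' b
  · obtain ⟨b, hb, hbc⟩ := hc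
    exact ⟨some b, .indirect s a l' _ hdir ha hskip hl' ⟨hcoin, hb, hbc⟩⟩
  · push Not at hc
    exact ⟨none, .indirect s a l' _ hdir ha hskip hl' ⟨hcoin, hc⟩⟩

/-- If the first slots of four consecutive rounds are committed, then all slots of the rounds before
are decided. -/
theorem exists_decided_of_four_committed {r : ℕ} {i₀ : Fin ℓ} (hi₀ : ∀ i, i₀ ≤ i)
    (hcoin : ∀ ρ < r, CoinOpen D ρ)
    (hcomm : ∀ j < 4, ∃ l, Decided D leader (r + j, i₀) (some l)) (s : Slot ℓ) (hs : s.1 < r) :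
    ∃ d, Decided D leader s d := by
  induction hn : r - s.1 using Nat.strong_induction_on generalizing s with
  | _ n ih =>
    by_cases hfar : certifyRound s.1 < r
    · obtain ⟨l, hl⟩ := hcomm 0 (by omega)
      refine exists_decided_of_later (hcoin _ hs) (s₁ := (r + 0, i₀)) hfar hl
        fun s' h' hb => ?_
      have hlt : s'.1 < r := by
        rcases Prod.lex_def.1 hb with h | ⟨-, h⟩
        · exact h
        · exact absurd h (hi₀ _).not_gt
      exact ih _ (by unfold certifyRound at h'; omega) s' hlt rfl
    · unfold certifyRound at hfar
      -- Here r ≤ s.1 + 3 < r + 3, so 1 ≤ j ≤ 3: the very first candidate anchor slot is committed,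
      -- and nothing lies in between.
      obtain ⟨j, hj⟩ : ∃ j, r + j = s.1 + 4 := ⟨s.1 + 4 - r, by omega⟩
      obtain ⟨l, hl⟩ := hcomm j (by omega)
      refine exists_decided_of_later (hcoin _ hs) (s₁ := (r + j, i₀))
        (by simp only [certifyRound]; omega) hl fun s' h' hb => ?_
      rcases Prod.lex_def.1 hb with h | ⟨-, h⟩
      · simp only [certifyRound] at h' h
        omega
      · exact absurd h (hi₀ _).not_gt

/-- The least slot committed with a block above `b` delivers it; being no later than `s`, it has
only decided slots before it. -/
theorem deliveredIn_of_decided {b l : Block f Tx} {s : Slot ℓ}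
    (hs : Decided D leader s (some l)) (hb : b.InHistory l)
    (hbefore : ∀ s' : Slot ℓ, s'.Before s → ∃ d, Decided D leader s' d) :
    DeliveredIn D leader b := by
  obtain ⟨a, ⟨l', hl', hbl'⟩, hmin⟩ := Slot.before_wf.has_min
    {a : Slot ℓ | ∃ l, Decided D leader a (some l) ∧ b.InHistory l} ⟨s, l, hs, hb⟩
  refine ⟨a, l', hl', hbl', fun s' h' => ?_, fun s' h' l'' hd hbl => hmin s' ⟨l'', hd, hbl⟩ h'⟩
  rcases Slot.before_trichotomy a s with h | rfl | h
  · exact hbefore s' (Slot.before_trans h' h)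
  · exact hbefore s' h'
  · exact absurd h (hmin s ⟨l, hs, hb⟩)

end Decisions

-- Validity along a single execution

/-- Validity holds if, in arbitrarily late sequences of four consecutive rounds, the first leaders
belong to the common core as soon as it is not empty. -/
theorem Execution.FollowsProtocol.validity {f ℓ : ℕ} {Tx : Type*} {X : Execution f ℓ Tx}
    (hX : X.FollowsProtocol) {i₀ : Fin ℓ} (hi₀ : ∀ i, i₀ ≤ i)
    (hlead : ∀ m, ∃ r, m ≤ r ∧ ∀ j < 4, (∃ v, X.CommonCore (r + j) v) →
      X.CommonCore (r + j) (X.leader (r + j) i₀)) : X.Validity := by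
  intro v R b hv hb u hu
  obtain ⟨T, hT⟩ := hX.exists_forall_honest_iff
  have hS : ∀ w, ∃ t, X.Honest w → b ∈ X.dag w t := by
    intro w
    by_cases hw : X.Honest w
    · exact (hX.exists_mem_dag hv hw hb).imp fun t ht _ => ht
    · exact ⟨0, fun h => absurd h hw⟩
  choose S hS using hS
  -- The three summands ensure that corruption has stopped, that round r is above that of `b`, and
  -- that the leader holds `b` when it proposes.
  obtain ⟨r, hr, hlead⟩ := hlead (T + (R + 1) + Finset.univ.sup S)
  -- The last round of the window is r+3, and its certify round is r+6.
  obtain ⟨t, ht⟩ := hX.exists_forall_proposal_mem_dag hu (r + 7)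
  have hcore : ∀ j < 4, X.CommonCore (r + j) (X.leader (r + j) i₀) := fun j hj =>
    hlead j hj (hX.exists_commonCore (hT _ (by omega)) (hT _ (by omega)))
  have hcomm : ∀ j < 4, ∃ l, X.proposal (X.leader (r + j) i₀) (r + j) = some l ∧
      Decided (X.dag u t) X.leader (r + j, i₀) (some l) := by
    intro j hj
    have h2 := hT (r + j + 2) (by omega)
    obtain ⟨l, hl⟩ := hX.exists_proposal (r + j) _ ((h2 _).1 (hcore j hj).1)
    exact ⟨l, hl, .direct _ _ (hX.directDecision_of_commonCore h2 (hcore j hj) hl hu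
      fun v R b hR => ht v R b (by omega))⟩
  have hcoin : ∀ ρ < r, CoinOpen (X.dag u t) ρ := by
    intro ρ hρ
    refine hX.isQuorum_of_honest fun w hw => ?_
    obtain ⟨c, hc⟩ := hX.exists_proposal (ρ + 3) w hw
    obtain ⟨hca, hcr, -⟩ := hX.proposal_valid w _ c hw hc
    exact ⟨c, ⟨ht w _ c (by omega) hw hc, hcr⟩, hca⟩
  obtain ⟨l, hl, hdl⟩ := hcomm 0 (by omega)
  have hw : X.Honest (X.leader (r + 0) i₀) :=
    (hT (r + 0 + 2) (by omega) _).1 (hcore 0 (by omega)).1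
  refine ⟨t, deliveredIn_of_decided hdl ?_ fun s' hs' => ?_⟩
  · refine hX.proposal_refers _ _ l hw hl b (hX.dag_mono hw ?_ (hS _ hw)) ?_
    · have h1 := hX.le_proposalTime hw (r + 0)
      have h2 := Finset.le_sup (f := S) (Finset.mem_univ (X.leader (r + 0) i₀))
      omega
    · rw [(hX.proposal_valid v R b hv hb).2.1]
      omega
  · refine exists_decided_of_four_committed hi₀ hcoin
      (fun j hj => (hcomm j hj).imp fun l h => h.2) s' ?_
    rcases Prod.lex_def.1 hs' with h | ⟨-, h⟩
    · exact h
    · exact absurd h (hi₀ _).not_gt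
-- Fair coins against predictable guesses
section Coin

variable {Ω V : Type*} [mΩ : MeasurableSpace Ω] {μ : Measure Ω} {ℱ : Filtration ℕ mΩ}
  [Fintype V] [MeasurableSpace V] [MeasurableSingletonClass V] {L c : ℕ → Ω → V} {q : ℝ≥0∞}

/-- A fair coin agrees with a guess that is made beforehand with the probability `q`. -/
theorem measure_inter_coin_eq_guess
    (hfair : ∀ r v (E : Set Ω), MeasurableSet[ℱ (r + 2)] E →
      μ (E ∩ {ω | L r ω = v}) = μ E * q)
    (hc : ∀ r, Measurable[ℱ (r + 2)] (c r)) (r : ℕ) {E : Set Ω} (hE : MeasurableSet[ℱ (r + 2)] E) :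
    μ (E ∩ {ω | L r ω = c r ω}) = μ E * q := by
  have hcm : ∀ v, MeasurableSet[ℱ (r + 2)] (c r ⁻¹' {v}) := fun v => hc r (measurableSet_singleton v)
  have hcm' : ∀ v ∈ Finset.univ, MeasurableSet (c r ⁻¹' {v}) := fun v _ => ℱ.le _ _ (hcm v)
  have key : ∀ S : Set Ω, μ S = ∑ v, μ (c r ⁻¹' {v} ∩ S) := by
    intro S
    have h := sum_measure_preimage_singleton (μ := μ.restrict S) Finset.univ hcm'
    simp only [Finset.coe_univ, Set.preimage_univ, Measure.restrict_apply_univ] at h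
    rw [← h]
    exact Finset.sum_congr rfl fun v hv => Measure.restrict_apply (hcm' v hv)
  -- Splitting by the value of the guess reduces to a constant guess, to which fairness applies.
  rw [key (E ∩ _), key E, Finset.sum_mul]
  refine Finset.sum_congr rfl fun v _ => ?_
  rw [← hfair r v _ ((hcm v).inter hE)]
  congr 1
  ext ω
  simp only [Set.mem_inter_iff, Set.mem_preimage, Set.mem_singleton_iff, Set.mem_ofPred_eq]
  constructor
  · rintro ⟨rfl, h, h'⟩
    exact ⟨⟨rfl, h⟩, h'⟩
  · rintro ⟨⟨rfl, h⟩, h'⟩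
    exact ⟨rfl, h, h'⟩

/-- The last coin, of round r+k-1, is released in round r+k+2, exactly the σ-algebra given which the
coin of round r+k is still fair. -/
theorem measurableSet_coin_eq_guess
    (hL : ∀ r, Measurable[ℱ (r + 3)] (L r)) (hc : ∀ r, Measurable[ℱ (r + 2)] (c r)) (r k : ℕ) :
    MeasurableSet[ℱ (r + k + 2)] {ω | ∀ j < k, L (r + j) ω = c (r + j) ω} := by
  have h : ∀ j < k, MeasurableSet[ℱ (r + k + 2)] {ω | L (r + j) ω = c (r + j) ω} := by
    intro j hj
    have h1 : Measurable[ℱ (r + k + 2)] (L (r + j)) :=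
      (hL (r + j)).mono (ℱ.mono (by omega)) le_rfl
    have h2 : Measurable[ℱ (r + k + 2)] (c (r + j)) :=
      (hc (r + j)).mono (ℱ.mono (by omega)) le_rfl
    exact measurableSet_eq_fun h1 h2
  have : {ω | ∀ j < k, L (r + j) ω = c (r + j) ω} =
      ⋂ j, ⋂ (_ : j < k), {ω | L (r + j) ω = c (r + j) ω} := by
    ext; simp
  rw [this]
  exact MeasurableSet.iInter fun j => MeasurableSet.iInter fun hj => h j hj

/-- Chain rule: conditioning on the first k agreements leaves the next coin fair, so each round
contributes a factor `q`. -/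
theorem measure_inter_coin_eq_guess_pow
    (hfair : ∀ r v (E : Set Ω), MeasurableSet[ℱ (r + 2)] E →
      μ (E ∩ {ω | L r ω = v}) = μ E * q)
    (hL : ∀ r, Measurable[ℱ (r + 3)] (L r)) (hc : ∀ r, Measurable[ℱ (r + 2)] (c r)) (r : ℕ)
    {E : Set Ω} (hE : MeasurableSet[ℱ (r + 2)] E) (k : ℕ) :
    μ (E ∩ {ω | ∀ j < k, L (r + j) ω = c (r + j) ω}) = μ E * q ^ k := by
  induction k with
  | zero => simp
  | succ k ih =>
    have : {ω | ∀ j < k + 1, L (r + j) ω = c (r + j) ω} =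
        {ω | ∀ j < k, L (r + j) ω = c (r + j) ω} ∩ {ω | L (r + k) ω = c (r + k) ω} := by
      ext ω
      simp only [Set.mem_inter_iff, Set.mem_ofPred_eq]
      exact Nat.forall_lt_succ_right
    rw [this, ← Set.inter_assoc, measure_inter_coin_eq_guess hfair hc, ih, pow_succ, mul_assoc]
    exact (ℱ.mono (by omega) _ hE).inter (measurableSet_coin_eq_guess hL hc r k)

/-- Almost surely, a fair coin agrees with guesses made beforehand in infinitely many sequences of
`k` consecutive rounds. -/
theorem ae_exists_coin_eq_guess [IsProbabilityMeasure μ] (hq : q ≠ 0)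
    (hfair : ∀ r v (E : Set Ω), MeasurableSet[ℱ (r + 2)] E →
      μ (E ∩ {ω | L r ω = v}) = μ E * q)
    (hL : ∀ r, Measurable[ℱ (r + 3)] (L r)) (hc : ∀ r, Measurable[ℱ (r + 2)] (c r)) (k : ℕ) :
    ∀ᵐ ω ∂μ, ∀ m, ∃ r, m ≤ r ∧ ∀ j < k, L (r + j) ω = c (r + j) ω := by
  rw [ae_all_iff]
  intro m
  let G : ℕ → Set Ω := fun r => {ω | ∀ j < k, L (r + j) ω = c (r + j) ω}
  -- `N K`: the first K windows, spaced by k, all fail. It is known before the coins of the next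
  -- window, whose failure contributes a factor 1 - q^k < 1.
  let N : ℕ → Set Ω := fun K => {ω | ∀ i < K, ω ∉ G (m + k * i)}
  have hN : ∀ K, N (K + 1) = N K \ G (m + k * K) := by
    intro K
    ext ω
    simp only [N, Set.mem_sdiff, Set.mem_ofPred_eq]
    exact Nat.forall_lt_succ_right
  have hNm : ∀ K, MeasurableSet[ℱ (m + k * K + 2)] (N K) := by
    intro K
    induction K with
    | zero => simp [N]
    | succ K ih =>
      rw [hN, Nat.mul_succ, ← Nat.add_assoc]
      exact (ℱ.mono (by omega) _ ih).diff (measurableSet_coin_eq_guess hL hc _ k)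
  have hNμ : ∀ K, μ (N K) = (1 - q ^ k) ^ K := by
    intro K
    induction K with
    | zero => simp [N]
    | succ K ih =>
      have h1 := measure_inter_coin_eq_guess_pow hfair hL hc _ (hNm K) k
      have hG : MeasurableSet (G (m + k * K)) :=
        ℱ.le _ _ (measurableSet_coin_eq_guess hL hc _ k)
      have h2 : μ (N K \ G (m + k * K)) = μ (N K) - μ (N K ∩ G (m + k * K)) := by
        rw [← measure_inter_add_sdiff (N K) hG,
          ENNReal.add_sub_cancel_left (measure_ne_top _ _)]
      rw [hN, h2, h1, pow_succ, ← ih, ENNReal.mul_sub (fun _ _ => measure_ne_top _ _), mul_one]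
  have hlt : 1 - q ^ k < 1 :=
    ENNReal.sub_lt_self ENNReal.one_ne_top one_ne_zero (pow_ne_zero k hq)
  refine le_antisymm (ge_of_tendsto' (ENNReal.tendsto_pow_atTop_nhds_zero_of_lt_one hlt)
    fun K => ?_) zero_le
  rw [← hNμ K]
  refine measure_mono fun ω hω i _ hi => hω ⟨m + k * i, by omega, hi⟩

end Coin

-- The common core is known before the coin

section Networks

variable {f ℓ : ℕ} {Tx Ω : Type*} [mΩ : MeasurableSpace Ω] {μ : Measure Ω} {ℱ : Filtration ℕ mΩ}
  {X : Ω → Execution f ℓ Tx}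

/-- The core refers to corruption through round r+2, not to honesty, which depends on the future.
The sets `W` range over a finite type, and proposals enter in the form of `proposal_known`. -/
theorem AsynchronousNetwork.measurableSet_commonCore (h : AsynchronousNetwork μ ℱ X) (r : ℕ)
    (v : Validator f) : MeasurableSet[ℱ (r + 2)] {ω | (X ω).CommonCore r v} := by
  have hf : ∀ w, MeasurableSet[ℱ (r + 2)] {ω | w ∉ (X ω).faulty (r + 2)} := fun w =>
    (h.faulty_known (r + 2) w).compl
  have hE : ∀ (w : Validator f) (W : Finset (Validator f)),
      MeasurableSet[ℱ (r + 2)] {ω | w ∈ W → w ∉ (X ω).faulty (r + 2) ∧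
        (w ∉ (X ω).faulty (r + 1) ∧
        ∃ c ∈ {c : Block f Tx | ∃ p ∈ c.parents, p.author = v ∧ p.round = r},
          (X ω).proposal w (r + 1) = some c)} := by
    intro w W
    by_cases hw : w ∈ W
    · simp only [hw, true_imp_iff]
      exact (hf w).inter (ℱ.mono (by omega) _ (h.proposal_known (r + 1) w _))
    · simp [hw]
  have : {ω | (X ω).CommonCore r v} = {ω | v ∉ (X ω).faulty (r + 2)} ∩
      ⋃ W : Finset (Validator f), ⋃ (_ : f + 1 ≤ W.card), ⋂ w,
        {ω | w ∈ W → w ∉ (X ω).faulty (r + 2) ∧ (w ∉ (X ω).faulty (r + 1) ∧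
        ∃ c ∈ {c : Block f Tx | ∃ p ∈ c.parents, p.author = v ∧ p.round = r},
          (X ω).proposal w (r + 1) = some c)} := by
    ext ω
    simp only [Execution.CommonCore, Set.mem_inter_iff, Set.mem_iUnion, Set.mem_iInter,
      Set.mem_ofPred_eq, exists_prop]
  rw [this]
  exact (hf v).inter (MeasurableSet.iUnion fun W => MeasurableSet.iUnion fun _ =>
    MeasurableSet.iInter fun w => hE w W)

/-- A validator of the common core of round `r` can be chosen with the information available through
round `r + 2`. -/
theorem AsynchronousNetwork.exists_measurable_commonCore (h : AsynchronousNetwork μ ℱ X) (r : ℕ) :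
    ∃ c : Ω → Validator f, Measurable[ℱ (r + 2)] c ∧
      ∀ ω, (∃ v, (X ω).CommonCore r v) → (X ω).CommonCore r (c ω) := by
  classical
  -- The choice depends only on the core, one of finitely many predicates, so measurability is
  -- automatic; 0 is a dummy for an empty core.
  let g : (Validator f → Prop) → Validator f := fun P => if hP : ∃ v, P v then hP.choose else 0
  refine ⟨fun ω => g fun v => (X ω).CommonCore r v, ?_, fun ω hω => ?_⟩
  · refine (measurable_of_finite g).comp ?_
    exact @measurable_pi_lambda _ _ _ (ℱ (r + 2)) _ _ fun v =>
      (@measurableSet_setOfPred _ (ℱ (r + 2)) _).1 (h.measurableSet_commonCore r v)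
  · simp only [g, dif_pos hω]
    exact hω.choose_spec

theorem AsynchronousNetwork.ae_validity [IsProbabilityMeasure μ] (hℓ : 1 ≤ ℓ)
    (h : AsynchronousNetwork μ ℱ X) : ∀ᵐ ω ∂μ, (X ω).Validity := by
  choose c hc hcore using h.exists_measurable_commonCore
  let i₀ : Fin ℓ := ⟨0, hℓ⟩
  have hcoin := ae_exists_coin_eq_guess (μ := μ) (L := fun r ω => (X ω).leader r i₀)
    (q := ((3 * f + 1 : ℕ) : ℝ≥0∞)⁻¹) (ENNReal.inv_ne_zero.2 (ENNReal.natCast_ne_top _))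
    (fun r v E hE => h.coin_fair r i₀ v E hE)
    (fun r => @measurable_to_countable' _ _ _ _ (ℱ (r + 3)) _ fun v => h.coin_known r i₀ v) hc 4
  filter_upwards [h.follows, hcoin] with ω hω hr
  refine hω.validity (i₀ := i₀) (fun i => Nat.zero_le i.1) fun m => ?_
  obtain ⟨r, hmr, hr⟩ := hr m
  refine ⟨r, hmr, fun j hj hex => ?_⟩
  rw [hr j hj]
  exact hcore (r + j) ω hex

end Networks

theorem mainTheorem5 {f ℓ : ℕ} (hℓ : 1 ≤ ℓ) (hℓn : ℓ ≤ 3 * f + 1) {Tx : Type*} {Ω : Type*}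
    [mΩ : MeasurableSpace Ω] (μ : Measure Ω) [IsProbabilityMeasure μ] (ℱ : Filtration ℕ mΩ)
    (X : Ω → Execution f ℓ Tx) :
    (AsynchronousNetwork μ ℱ X → ∀ᵐ ω ∂μ, (X ω).Validity) ∧
    (RandomNetwork μ ℱ X → ∀ᵐ ω ∂μ, (X ω).Validity) :=
  ⟨fun h => h.ae_validity hℓ, fun h => h.toAsynchronousNetwork.ae_validity hℓ⟩
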